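/- Let $n\ge 1$ and let $\mathcal A$ be a non-empty, possibly unbounded, set of real symmetric positive semi-definite $n\times n$ matrices. For a real symmetric $n\times n$ matrix $M$ put $$F(M)=\inf_{A\in\mathcal A}\operatorname{tr}(A^tMA)\in\mathbb R\cup\{-\infty\},\qquad \Gamma_{\mathcal A}=\{M \text{ symmetric}: F(M)>-\infty\},$$ and assume that the restriction of $F$ to $\Gamma_{\mathcal A}$ is continuous. Let $\Omega\subset\mathbb R^n$ be open and let $u\in C^2(\Omega)$ be $\mathcal A$-admissible, i.e. $D^2u(z)\in\Gamma_{\mathcal A}$ for every $z\in\Omega$. Let $\phi:(0,\infty)\to(0,\infty)$ satisfy $$\lim_{\varepsilon\to0^+}\phi(\varepsilon)=+\infty,\qquad \lim_{\varepsilon\to0^+}\varepsilon\,\phi(\varepsilon)=0 .$$ Then for every $x\in\Omega$ $$\inf_{\substack{A\in\mathcal A\\ A\le\phi(\varepsilon)I}}\ \frac{1}{|B_\varepsilon(0)|}\int_{B_\varepsilon(0)}u(x+Ay)\,dy-u(x)=\frac{\varepsilon^2}{2(n+2)}F(D^2u(x))+o(\varepsilon^2)\qquad\text{as }\varepsilon\to0^+,$$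 where $A\le\phi(\varepsilon)I$ means that $\phi(\varepsilon)I-A$ is positive semi-definite. Moreover, for all sufficiently small $\varepsilon>0$ the left-hand side is well defined and finite: the set of matrices over which the infimum is taken is non-empty, for each such $A$ one has $x+Ay\in\Omega$ for all $y\in B_\varepsilon(0)$ and $y\mapsto u(x+Ay)$ is integrable on $B_\varepsilon(0)$, and the averages are bounded below. -/

import Mathlib

open MeasureTheory Filter Topology Asymptotics
open scoped Matrix

noncomputable section

namespace MeanValue

/-- The operator `F(M) = inf_{A ∈ 𝒜} tr(Aᵗ M A)`, with the value `-∞` when the traces are not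
bounded below. -/
def F {n : ℕ} (𝒜 : Set (Matrix (Fin n) (Fin n) ℝ)) (M : Matrix (Fin n) (Fin n) ℝ) : EReal :=
  ⨅ A ∈ 𝒜, ((Matrix.trace (Aᵀ * M * A) : ℝ) : EReal)

/-- The cone `Γ_𝒜` of symmetric matrices `M` with `F(M) > -∞`. -/
def Gam {n : ℕ} (𝒜 : Set (Matrix (Fin n) (Fin n) ℝ)) : Set (Matrix (Fin n) (Fin n) ℝ) :=
  {M | M.IsSymm ∧ ⊥ < F 𝒜 M}

/-- The Hessian matrix `D²u(x)`, with entries the second partial derivatives of `u` at `x`. -/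
def hessian {n : ℕ} (u : EuclideanSpace ℝ (Fin n) → ℝ) (x : EuclideanSpace ℝ (Fin n)) :
    Matrix (Fin n) (Fin n) ℝ :=
  Matrix.of fun i j =>
    fderiv ℝ (fderiv ℝ u) x (EuclideanSpace.single i 1) (EuclideanSpace.single j 1)

/-- `u` is `C²` in (the open set) `Ω` and `D²u(x) ∈ Γ_𝒜` for every `x ∈ Ω`. -/
def IsAdmissible {n : ℕ} (𝒜 : Set (Matrix (Fin n) (Fin n) ℝ))
    (Ω : Set (EuclideanSpace ℝ (Fin n))) (u : EuclideanSpace ℝ (Fin n) → ℝ) : Prop :=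
  ContDiffOn ℝ 2 u Ω ∧ ∀ x ∈ Ω, hessian u x ∈ Gam 𝒜

/-- The matrices `A ∈ 𝒜` with `A ≤ r I`, i.e. such that `r I - A` is positive semi-definite. -/
def truncation {n : ℕ} (𝒜 : Set (Matrix (Fin n) (Fin n) ℝ)) (r : ℝ) :
    Set (Matrix (Fin n) (Fin n) ℝ) :=
  {A | A ∈ 𝒜 ∧ (r • (1 : Matrix (Fin n) (Fin n) ℝ) - A).PosSemidef}

/-- The average of `y ↦ u(x + A y)` over the ball `B_ε(0)`. -/
def ballMean {n : ℕ} (u : EuclideanSpace ℝ (Fin n) → ℝ) (x : EuclideanSpace ℝ (Fin n))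
    (ε : ℝ) (A : Matrix (Fin n) (Fin n) ℝ) : ℝ :=
  ⨍ y in Metric.ball (0 : EuclideanSpace ℝ (Fin n)) ε,
    u (x + Matrix.toEuclideanCLM (n := Fin n) (𝕜 := ℝ) A y)

end MeanValue

end

namespace MeanValue

/-! For fixed `A` the Laplacian of `y ↦ u (x + A y)` is `tr (Aᵗ D²u(x + A y) A)`. If it is at least
`c` on the ball of radius `ε`, the mean exceeds `u x` by at least `c ε² / (2(n+2))`, and
symmetrically from above. A Taylor remainder would be multiplied by `‖A‖²`, which is not bounded
over `𝒜`; these one-sided inequalities avoid that loss.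

Lower bound: continuity of `F` on `Γ_𝒜` bounds the traces at all points near `x` by `F(D²u(x)) - η`,
for all `A ∈ 𝒜` at once (`eventually_forall_le_trace`), and `ε φ(ε) → 0` keeps `x + A y` near `x`.
Upper bound: one near-minimiser of `F(D²u(x))` is fixed; it is admitted for small `ε` because `φ →
∞`.

The mean value inequality (`le_average_sub_of_le_lapComp`) comes from differentiating the average of
`U (x + t L y)` in `t` and integrating by parts against `cap`, whose gradient in the unit ball is
`-y`. -/

/-- Half of the positive part of `1 - ‖y‖²`. -/
noncomputable def cap {E : Type*} [NormedAddCommGroup E] (y : E) : ℝ := (1 - (min ‖y‖ 1) ^ 2) / 2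

/-! ### The integration by parts weight. -/

section cap

variable {E : Type*} [NormedAddCommGroup E]

lemma cap_eq_of_norm_le {y : E} (h : ‖y‖ ≤ 1) : cap y = (1 - ‖y‖ ^ 2) / 2 := by
  rw [cap, min_eq_left h]

lemma cap_eq_zero {y : E} (h : 1 ≤ ‖y‖) : cap y = 0 := by
  rw [cap, min_eq_right h]; norm_num

lemma cap_nonneg (y : E) : 0 ≤ cap y := by
  have h1 : 0 ≤ min ‖y‖ 1 := le_min (norm_nonneg y) zero_le_one
  have h2 : min ‖y‖ 1 ≤ 1 := min_le_right _ _
  unfold cap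
  nlinarith

lemma lipschitzWith_cap : LipschitzWith 1 (cap : E → ℝ) := by
  refine LipschitzWith.of_dist_le_mul fun y z => ?_
  have hmin : |min ‖y‖ 1 - min ‖z‖ 1| ≤ ‖y - z‖ :=
    calc |min ‖y‖ 1 - min ‖z‖ 1| ≤ max |‖y‖ - ‖z‖| |(1 : ℝ) - 1| := abs_min_sub_min_le_max _ _ _ _
      _ ≤ ‖y - z‖ := by simpa using abs_norm_sub_norm_le y z
  have hy : 0 ≤ min ‖y‖ 1 := le_min (norm_nonneg y) zero_le_one
  have hz : 0 ≤ min ‖z‖ 1 := le_min (norm_nonneg z) zero_le_one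
  have hy' : min ‖y‖ 1 ≤ 1 := min_le_right _ _
  have hz' : min ‖z‖ 1 ≤ 1 := min_le_right _ _
  rw [Real.dist_eq, dist_eq_norm, NNReal.coe_one, one_mul]
  refine le_trans ?_ hmin
  have : cap y - cap z = -((min ‖y‖ 1 + min ‖z‖ 1) / 2 * (min ‖y‖ 1 - min ‖z‖ 1)) := by
    unfold cap; ring
  rw [this, abs_neg, abs_mul, abs_of_nonneg (by positivity)]
  exact mul_le_of_le_one_left (abs_nonneg _) (by linarith)

lemma hasCompactSupport_cap [ProperSpace E] : HasCompactSupport (cap : E → ℝ) := by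
  refine HasCompactSupport.of_support_subset_isCompact (isCompact_closedBall 0 1) fun y hy => ?_
  by_contra h
  exact hy (cap_eq_zero (by simpa using (not_le.1 (mt mem_closedBall_zero_iff.2 h)).le))

/-- The direction is `-v` because integration by parts moves the derivative onto `cap` in this form.
-/
lemma lineDeriv_cap_of_norm_lt {E : Type*} [NormedAddCommGroup E] [InnerProductSpace ℝ E]
    {y : E} (h : ‖y‖ < 1) (v : E) : lineDeriv ℝ cap y (-v) = inner ℝ y v := by
  have h1 : HasFDerivAt (fun z : E => (1 - ‖z‖ ^ 2) / 2)
      ((1 / 2 : ℝ) • -((2 : ℕ) • (innerSL ℝ y : E →L[ℝ] ℝ))) y := by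
    have := ((hasStrictFDerivAt_norm_sq y).hasFDerivAt.const_sub 1).const_mul (1 / 2 : ℝ)
    refine this.congr_of_eventuallyEq (Eventually.of_forall fun z => ?_)
    ring
  have h2 : cap =ᶠ[𝓝 y] fun z : E => (1 - ‖z‖ ^ 2) / 2 := by
    filter_upwards [continuous_norm.continuousAt.eventually_lt continuousAt_const h] with z hz
    exact cap_eq_of_norm_le hz.le
  rw [((h1.congr_of_eventuallyEq h2).hasLineDerivAt (-v)).lineDeriv]
  simp

lemma lineDeriv_cap_of_lt_norm {E : Type*} [NormedAddCommGroup E] [NormedSpace ℝ E]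
    {y : E} (h : 1 < ‖y‖) (v : E) : lineDeriv ℝ cap y v = 0 := by
  have h2 : cap =ᶠ[𝓝 y] fun _ : E => (0 : ℝ) := by
    filter_upwards [continuousAt_const.eventually_lt continuous_norm.continuousAt h] with z hz
    exact cap_eq_zero hz.le
  rw [(((hasFDerivAt_const (0 : ℝ) y).congr_of_eventuallyEq h2).hasLineDerivAt v).lineDeriv]
  simp

end cap

/-! ### Integration by parts and the mass of the weight. -/

variable {n : ℕ}

lemma hasFDerivAt_fderiv_comp_apply {U : EuclideanSpace ℝ (Fin n) → ℝ} (hU : ContDiff ℝ 2 U)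
    (x : EuclideanSpace ℝ (Fin n)) (L : EuclideanSpace ℝ (Fin n) →L[ℝ] EuclideanSpace ℝ (Fin n))
    (w y : EuclideanSpace ℝ (Fin n)) :
    HasFDerivAt (fun y => fderiv ℝ U (x + L y) w)
      (((fderiv ℝ (fderiv ℝ U) (x + L y)).comp L).flip w) y := by
  have h1 : HasFDerivAt (fderiv ℝ U) (fderiv ℝ (fderiv ℝ U) (x + L y)) (x + L y) :=
    ((hU.fderiv_right (m := 1) (by norm_num)).differentiable (by norm_num) _).hasFDerivAt
  have h2 : HasFDerivAt (fun y => x + L y) L y := L.hasFDerivAt.const_add x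
  have := (h1.comp y h2).clm_apply (hasFDerivAt_const w y)
  simpa [Function.comp_def] using this

/-- The Laplacian of `y ↦ U (x + L y)`. -/
noncomputable def lapComp (U : EuclideanSpace ℝ (Fin n) → ℝ) (x : EuclideanSpace ℝ (Fin n))
    (L : EuclideanSpace ℝ (Fin n) →L[ℝ] EuclideanSpace ℝ (Fin n)) (y : EuclideanSpace ℝ (Fin n)) : ℝ :=
  ∑ i, fderiv ℝ (fderiv ℝ U) (x + L y) (L (EuclideanSpace.single i 1))
    (L (EuclideanSpace.single i 1))

lemma continuous_lapComp {U : EuclideanSpace ℝ (Fin n) → ℝ} (hU : ContDiff ℝ 2 U)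
    (x : EuclideanSpace ℝ (Fin n)) (L : EuclideanSpace ℝ (Fin n) →L[ℝ] EuclideanSpace ℝ (Fin n)) :
    Continuous (lapComp U x L) := by
  have h1 : Continuous (fderiv ℝ (fderiv ℝ U)) :=
    (hU.fderiv_right (m := 1) (by norm_num)).continuous_fderiv (by norm_num)
  unfold lapComp
  fun_prop

/-- Each second derivative along `L eᵢ` is integrated by parts against `cap`, leaving the factor
`-∂ᵢ cap = yᵢ` inside the ball and `0` outside. -/
lemma integral_cap_mul_lapComp {U : EuclideanSpace ℝ (Fin n) → ℝ} (hU : ContDiff ℝ 2 U)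
    (hc : HasCompactSupport U) (x : EuclideanSpace ℝ (Fin n))
    (L : EuclideanSpace ℝ (Fin n) →L[ℝ] EuclideanSpace ℝ (Fin n)) :
    ∫ y in Metric.ball 0 1, fderiv ℝ U (x + L y) (L y) = ∫ y, lapComp U x L y * cap y := by
  have hU1 : ContDiff ℝ 1 (fderiv ℝ U) := hU.fderiv_right (m := 1) (by norm_num)
  have hcont : Continuous (fderiv ℝ U) := hU1.continuous
  have hcont2 : Continuous (fderiv ℝ (fderiv ℝ U)) := hU1.continuous_fderiv (by norm_num)
  obtain ⟨C, hC⟩ := ContDiff.lipschitzWith_of_hasCompactSupport (hc.fderiv ℝ) hU1 (by norm_num)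
  let b : Fin n → EuclideanSpace ℝ (Fin n) := fun i => EuclideanSpace.single i 1
  let f : Fin n → EuclideanSpace ℝ (Fin n) → ℝ := fun i y => fderiv ℝ U (x + L y) (L (b i))
  have hfL (i : Fin n) : ∃ D, LipschitzWith D (f i) := by
    have h1 : LipschitzWith ‖L‖₊ (fun y => x + L y) := by
      refine LipschitzWith.of_dist_le_mul fun y z => ?_
      rw [dist_add_left]
      exact L.lipschitz.dist_le_mul y z
    have h2 : LipschitzWith ‖ContinuousLinearMap.apply ℝ ℝ (L (b i))‖₊
      (ContinuousLinearMap.apply ℝ ℝ (L (b i))) := ContinuousLinearMap.lipschitz _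
    exact ⟨_, h2.comp (hC.comp h1)⟩
  have hparts (i : Fin n) :
      ∫ y, fderiv ℝ (fderiv ℝ U) (x + L y) (L (b i)) (L (b i)) * cap y =
        ∫ y in Metric.ball 0 1, y i * f i y := by
    obtain ⟨D, hD⟩ := hfL i
    have key := LipschitzWith.integral_lineDeriv_mul_eq (μ := volume) hD lipschitzWith_cap
      hasCompactSupport_cap (b i)
    have h1 (y : EuclideanSpace ℝ (Fin n)) : lineDeriv ℝ (f i) y (b i) =
        fderiv ℝ (fderiv ℝ U) (x + L y) (L (b i)) (L (b i)) := by
      rw [((hasFDerivAt_fderiv_comp_apply hU x L (L (b i)) y).hasLineDerivAt (b i)).lineDeriv]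
      simp
    simp_rw [h1] at key
    rw [key, ← integral_indicator Metric.isOpen_ball.measurableSet]
    refine integral_congr_ae ?_
    -- `cap` has a kink on the unit sphere, which is a null set.
    have hs : ∀ᵐ y : EuclideanSpace ℝ (Fin n), y ∉ Metric.sphere (0 : EuclideanSpace ℝ (Fin n)) 1 :=
      measure_eq_zero_iff_ae_notMem.1 (Measure.addHaar_sphere_of_ne_zero volume 0 one_ne_zero)
    filter_upwards [hs] with y hy
    rcases lt_trichotomy ‖y‖ 1 with h | h | h
    · rw [lineDeriv_cap_of_norm_lt h, Set.indicator_of_mem (by simpa using h)]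
      simp [b, EuclideanSpace.inner_single_right]
    · exact absurd (by simpa using h) hy
    · rw [lineDeriv_cap_of_lt_norm h, Set.indicator_of_notMem (by simpa using h.le), zero_mul]
  have hint (i : Fin n) : Integrable
      (fun y => fderiv ℝ (fderiv ℝ U) (x + L y) (L (b i)) (L (b i)) * cap y) := by
    refine Continuous.integrable_of_hasCompactSupport ?_ hasCompactSupport_cap.mul_left
    have := (lipschitzWith_cap (E := EuclideanSpace ℝ (Fin n))).continuous
    fun_prop
  have hint2 (i : Fin n) : IntegrableOn (fun y => y i * f i y) (Metric.ball 0 1) := by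
    refine ((Continuous.continuousOn ?_).integrableOn_compact
      (isCompact_closedBall 0 1)).mono_set Metric.ball_subset_closedBall
    fun_prop
  have hrhs : ∫ y, lapComp U x L y * cap y =
      ∑ i, ∫ y, fderiv ℝ (fderiv ℝ U) (x + L y) (L (b i)) (L (b i)) * cap y := by
    rw [← integral_finsetSum _ fun i _ => hint i]
    simp_rw [lapComp, Finset.sum_mul]
    rfl
  rw [hrhs]
  simp_rw [hparts]
  rw [← integral_finsetSum _ fun i _ => hint2 i]
  refine integral_congr_ae (Eventually.of_forall fun y => ?_)
  have hy : y = ∑ i, y i • b i := by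
    simpa [b] using ((EuclideanSpace.basisFun (Fin n) ℝ).sum_repr y).symm
  change fderiv ℝ U (x + L y) (L y) = ∑ i, y i * fderiv ℝ U (x + L y) (L (b i))
  have hLy : L y = ∑ i, y i • L (b i) := by
    conv_lhs => rw [hy, map_sum]
    simp
  generalize fderiv ℝ U (x + L y) = T
  rw [hLy]
  simp

/-- In polar coordinates, with `n = m + 1`, the radial integral is `1 / ((m+1)(m+3))`; the factor `n
= m + 1` from the sphere cancels. -/
lemma integral_cap (hn : 1 ≤ n) : ∫ y : EuclideanSpace ℝ (Fin n), cap y =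
    volume.real (Metric.ball (0 : EuclideanSpace ℝ (Fin n)) 1) / (n + 2) := by
  obtain ⟨m, rfl⟩ : ∃ m, n = m + 1 := ⟨n - 1, by omega⟩
  have h1 := integral_fun_norm_addHaar (E := EuclideanSpace ℝ (Fin (m + 1))) volume
    (fun r => (1 - (min r 1) ^ 2) / 2)
  have h2 : ∫ r in Set.Ioi (0 : ℝ), r ^ m * ((1 - (min r 1) ^ 2) / 2) =
      1 / (((m : ℝ) + 1) * (m + 3)) := by
    have h3 : ∫ r in Set.Ioi (0 : ℝ), r ^ m * ((1 - (min r 1) ^ 2) / 2) =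
        ∫ r in Set.Ioc (0 : ℝ) 1, r ^ m * ((1 - (min r 1) ^ 2) / 2) := by
      refine setIntegral_eq_of_subset_of_forall_sdiff_eq_zero measurableSet_Ioi
        Set.Ioc_subset_Ioi_self fun r hr => ?_
      have hr1 : 1 ≤ r := by
        by_contra h
        exact hr.2 ⟨hr.1, (not_le.1 h).le⟩
      rw [min_eq_right hr1]
      norm_num
    have h4 : ∫ r in Set.Ioc (0 : ℝ) 1, r ^ m * ((1 - (min r 1) ^ 2) / 2) =
        ∫ r in Set.Ioc (0 : ℝ) 1, (1 / 2 : ℝ) * (r ^ m - r ^ (m + 2)) := by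
      refine setIntegral_congr_fun measurableSet_Ioc fun r hr => ?_
      simp only [min_eq_left hr.2]
      ring
    rw [h3, h4, ← intervalIntegral.integral_of_le zero_le_one,
      intervalIntegral.integral_const_mul, intervalIntegral.integral_sub (by simp) (by simp),
      integral_pow, integral_pow]
    push_cast
    have : (m : ℝ) + 1 ≠ 0 := by positivity
    have : (m : ℝ) + 3 ≠ 0 := by positivity
    have : (m : ℝ) + 2 + 1 ≠ 0 := by positivity
    field_simp
    simp
    ring
  change ∫ y : EuclideanSpace ℝ (Fin (m + 1)), (1 - (min ‖y‖ 1) ^ 2) / 2 = _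
  rw [h1]
  simp only [finrank_euclideanSpace, Fintype.card_fin, Nat.add_sub_cancel, smul_eq_mul,
    nsmul_eq_mul]
  rw [h2]
  push_cast
  have : (m : ℝ) + 1 ≠ 0 := by positivity
  have : (m : ℝ) + 3 ≠ 0 := by positivity
  have : (m : ℝ) + 1 + 2 ≠ 0 := by positivity
  field_simp
  ring

/-! ### Mean value inequalities on the unit ball. -/

lemma lapComp_smul (U : EuclideanSpace ℝ (Fin n) → ℝ) (x : EuclideanSpace ℝ (Fin n))
    (L : EuclideanSpace ℝ (Fin n) →L[ℝ] EuclideanSpace ℝ (Fin n)) (t : ℝ)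
    (y : EuclideanSpace ℝ (Fin n)) :
    lapComp U x (t • L) y = t ^ 2 * lapComp U x L (t • y) := by
  simp only [lapComp, Finset.mul_sum, smul_apply, map_smul, smul_eq_mul]
  exact Finset.sum_congr rfl fun i _ => by ring

lemma lapComp_neg (U : EuclideanSpace ℝ (Fin n) → ℝ) (x : EuclideanSpace ℝ (Fin n))
    (L : EuclideanSpace ℝ (Fin n) →L[ℝ] EuclideanSpace ℝ (Fin n))
    (y : EuclideanSpace ℝ (Fin n)) : lapComp (-U) x L y = -lapComp U x L y := by
  have h1 : fderiv ℝ (-U) = -fderiv ℝ U := by ext1 z; exact fderiv_neg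
  have h2 : fderiv ℝ (-fderiv ℝ U) = -fderiv ℝ (fderiv ℝ U) := by ext1 z; exact fderiv_neg
  simp [lapComp, h1, h2]

lemma hasDerivAt_integral_ball_comp_smul {U : EuclideanSpace ℝ (Fin n) → ℝ}
    (hU : ContDiff ℝ 1 U) (hc : HasCompactSupport U) (x : EuclideanSpace ℝ (Fin n))
    (L : EuclideanSpace ℝ (Fin n) →L[ℝ] EuclideanSpace ℝ (Fin n)) (t : ℝ) :
    HasDerivAt (fun t : ℝ => ∫ y in Metric.ball 0 1, U (x + t • L y))
      (∫ y in Metric.ball 0 1, fderiv ℝ U (x + t • L y) (L y)) t := by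
  have hU0 := hU.continuous
  have hU1 : Continuous (fderiv ℝ U) := hU.continuous_fderiv (by norm_num)
  obtain ⟨C, hC⟩ := (hc.fderiv ℝ).exists_bound_of_continuous hU1
  have hint {f : EuclideanSpace ℝ (Fin n) → ℝ} (hf : Continuous f) :
      IntegrableOn f (Metric.ball 0 1) :=
    (hf.continuousOn.integrableOn_compact (isCompact_closedBall 0 1)).mono_set
      Metric.ball_subset_closedBall
  refine (hasDerivAt_integral_of_dominated_loc_of_deriv_le (s := Set.univ)
    (F := fun t y => U (x + t • L y)) (F' := fun t y => fderiv ℝ U (x + t • L y) (L y))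
    (bound := fun y => C * ‖L y‖) univ_mem ?_ (hint (by fun_prop)) ?_ ?_
    (hint (by fun_prop)) ?_).2
  · exact Eventually.of_forall fun t => Continuous.aestronglyMeasurable (by fun_prop)
  · exact Continuous.aestronglyMeasurable (by fun_prop)
  · exact Eventually.of_forall fun y s _ => (ContinuousLinearMap.le_opNorm _ _).trans
      (mul_le_mul_of_nonneg_right (hC _) (norm_nonneg _))
  · refine Eventually.of_forall fun y s _ => ?_
    have h1 : HasFDerivAt U (fderiv ℝ U (x + s • L y)) (x + s • L y) :=
      (hU.differentiable (by norm_num) _).hasFDerivAt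
    have h2 : HasDerivAt (fun s : ℝ => x + s • L y) (L y) s := by
      simpa using ((hasDerivAt_id s).smul_const (L y)).const_add x
    exact h1.comp_hasDerivAt s h2

/-- A quantitative sub-mean value inequality on the unit ball. -/
lemma le_average_sub_of_le_lapComp (hn : 1 ≤ n) {U : EuclideanSpace ℝ (Fin n) → ℝ}
    (hU : ContDiff ℝ 2 U) (hc : HasCompactSupport U) (x : EuclideanSpace ℝ (Fin n))
    (L : EuclideanSpace ℝ (Fin n) →L[ℝ] EuclideanSpace ℝ (Fin n)) {c : ℝ}
    (h : ∀ y ∈ Metric.ball (0 : EuclideanSpace ℝ (Fin n)) 1, c ≤ lapComp U x L y) :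
    c / (2 * (n + 2)) ≤ (⨍ y in Metric.ball 0 1, U (x + L y)) - U x := by
  set V := volume.real (Metric.ball (0 : EuclideanSpace ℝ (Fin n)) 1) with hV
  have hVpos : 0 < V :=
    ENNReal.toReal_pos (Metric.measure_ball_pos _ _ one_pos).ne' measure_ball_lt_top.ne
  set g : ℝ → ℝ := fun t => ∫ y in Metric.ball 0 1, U (x + t • L y) with hg
  have hgd := hasDerivAt_integral_ball_comp_smul (hU.of_le (by norm_num)) hc x L
  have hcapc := (lipschitzWith_cap (E := EuclideanSpace ℝ (Fin n))).continuous
  -- Integration by parts for `t • L` gives a factor `t²` from the Laplacian and `t` from the first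
  -- derivative; one `t` remains after division.
  have hderiv (t : ℝ) (h0 : 0 < t) (h1 : t < 1) : t * (c * (V / (n + 2))) ≤
      ∫ y in Metric.ball 0 1, fderiv ℝ U (x + t • L y) (L y) := by
    have key := integral_cap_mul_lapComp hU hc x (t • L)
    simp only [smul_apply, map_smul, smul_eq_mul, integral_const_mul] at key
    have hle : t ^ 2 * (c * (V / (n + 2))) ≤ ∫ y, lapComp U x (t • L) y * cap y := by
      rw [hV, ← integral_cap hn, ← mul_assoc, ← integral_const_mul]
      refine integral_mono
        ((hcapc.integrable_of_hasCompactSupport hasCompactSupport_cap).const_mul _)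
        (((continuous_lapComp hU x _).mul hcapc).integrable_of_hasCompactSupport
          hasCompactSupport_cap.mul_left) fun y => ?_
      rcases lt_or_ge ‖y‖ 1 with hy | hy
      · refine mul_le_mul_of_nonneg_right ?_ (cap_nonneg y)
        rw [lapComp_smul]
        refine mul_le_mul_of_nonneg_left (h _ ?_) (sq_nonneg t)
        rw [mem_ball_zero_iff, norm_smul, Real.norm_eq_abs, abs_of_pos h0]
        nlinarith [norm_nonneg y]
      · simp [cap_eq_zero hy]
    rw [← key] at hle
    refine le_of_mul_le_mul_left ?_ h0
    linarith
  -- The subtracted term is the primitive of the lower bound in `hderiv`; comparing `t = 0` and `t =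
  -- 1` gives the claim.
  have hmono : MonotoneOn (fun t => g t - t ^ 2 * (c * (V / (n + 2)) / 2)) (Set.Icc 0 1) := by
    have hd (t : ℝ) : HasDerivAt (fun t => g t - t ^ 2 * (c * (V / (n + 2)) / 2))
        ((∫ y in Metric.ball 0 1, fderiv ℝ U (x + t • L y) (L y)) -
          t * (c * (V / (n + 2)))) t := by
      refine ((hgd t).sub ((hasDerivAt_pow 2 t).mul_const (c * (V / (n + 2)) / 2))).congr_deriv ?_
      norm_num
      ring
    refine monotoneOn_of_deriv_nonneg (convex_Icc 0 1)
      (fun t _ => (hd t).continuousAt.continuousWithinAt)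
      (fun t _ => (hd t).differentiableAt.differentiableWithinAt) fun t ht => ?_
    rw [interior_Icc] at ht
    rw [(hd t).deriv]
    linarith [hderiv t ht.1 ht.2]
  have h01 := hmono (Set.left_mem_Icc.2 zero_le_one) (Set.right_mem_Icc.2 zero_le_one) zero_le_one
  have hg0 : g 0 = V * U x := by simp [hg, hV]
  have hg1 : g 1 = V * ⨍ y in Metric.ball 0 1, U (x + L y) := by
    rw [setAverage_eq, smul_eq_mul, ← hV, mul_inv_cancel_left₀ hVpos.ne']
    simp [hg]
  simp only [hg0, hg1] at h01
  refine le_of_mul_le_mul_left ?_ hVpos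
  have : V * (c / (2 * (n + 2))) = c * (V / (n + 2)) / 2 := by
    have : (n : ℝ) + 2 ≠ 0 := by positivity
    field_simp
  rw [this]
  linarith

/-- A quantitative super-mean value inequality on the unit ball. -/
lemma average_sub_le_of_lapComp_le (hn : 1 ≤ n) {U : EuclideanSpace ℝ (Fin n) → ℝ}
    (hU : ContDiff ℝ 2 U) (hc : HasCompactSupport U) (x : EuclideanSpace ℝ (Fin n))
    (L : EuclideanSpace ℝ (Fin n) →L[ℝ] EuclideanSpace ℝ (Fin n)) {c : ℝ}
    (h : ∀ y ∈ Metric.ball (0 : EuclideanSpace ℝ (Fin n)) 1, lapComp U x L y ≤ c) :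
    (⨍ y in Metric.ball 0 1, U (x + L y)) - U x ≤ c / (2 * (n + 2)) := by
  have := le_average_sub_of_le_lapComp hn hU.neg hc.neg x L (c := -c) fun y hy => by
    rw [show (fun z => -U z) = -U from rfl, lapComp_neg]
    exact neg_le_neg (h y hy)
  have h2 : (⨍ y in Metric.ball (0 : EuclideanSpace ℝ (Fin n)) 1, -U (x + L y)) =
      -⨍ y in Metric.ball (0 : EuclideanSpace ℝ (Fin n)) 1, U (x + L y) := by
    simp [setAverage_eq]
  rw [h2, neg_div] at this
  linarith

/-! ### Traces and the order on matrices. -/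

lemma lapComp_toEuclideanCLM (U : EuclideanSpace ℝ (Fin n) → ℝ) (x : EuclideanSpace ℝ (Fin n))
    (A : Matrix (Fin n) (Fin n) ℝ) (y : EuclideanSpace ℝ (Fin n)) :
    lapComp U x (Matrix.toEuclideanCLM (n := Fin n) (𝕜 := ℝ) A) y =
      (Aᵀ * hessian U (x + Matrix.toEuclideanCLM (n := Fin n) (𝕜 := ℝ) A y) * A).trace := by
  have hA (i : Fin n) : Matrix.toEuclideanCLM (n := Fin n) (𝕜 := ℝ) A (EuclideanSpace.single i 1) =
      ∑ j, A j i • (EuclideanSpace.single j 1 : EuclideanSpace ℝ (Fin n)) := by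
    ext k
    simp [Finset.sum_apply, Pi.single_apply]
  unfold lapComp
  simp_rw [hA]
  generalize x + Matrix.toEuclideanCLM (n := Fin n) (𝕜 := ℝ) A y = z
  simp only [Matrix.trace, Matrix.diag_apply, Matrix.mul_apply, Matrix.transpose_apply, hessian,
    Matrix.of_apply, map_sum, map_smul, sum_apply, smul_apply,
    smul_eq_mul, Finset.mul_sum, Finset.sum_mul]
  refine Finset.sum_congr rfl fun i _ => Finset.sum_congr rfl fun j _ =>
    Finset.sum_congr rfl fun k _ => by ring

/-- `A` commutes with `B = rI - A`, so `ABA + BAB = r(rA - A²)` is positive semi-definite. Hence `A²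
≤ rA ≤ r²I`. -/
lemma norm_toEuclideanCLM_le {A : Matrix (Fin n) (Fin n) ℝ} {r : ℝ} (hr : 0 < r)
    (hA : A.PosSemidef) (hB : (r • (1 : Matrix (Fin n) (Fin n) ℝ) - A).PosSemidef)
    (y : EuclideanSpace ℝ (Fin n)) :
    ‖Matrix.toEuclideanCLM (n := Fin n) (𝕜 := ℝ) A y‖ ≤ r * ‖y‖ := by
  set B := r • (1 : Matrix (Fin n) (Fin n) ℝ) - A with hBdef
  have hAs : Aᴴ = A := hA.isHermitian
  have hBs : Bᴴ = B := hB.isHermitian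
  have h1 := (hB.conjTranspose_mul_mul_same A).add (hA.conjTranspose_mul_mul_same B)
  rw [hAs, hBs] at h1
  have h2 : A * B * A + B * A * B = r • (r • A - A * A) := by
    simp only [hBdef, mul_sub, sub_mul, smul_mul_assoc, mul_smul_comm, one_mul, mul_one, smul_sub]
    abel
  rw [h2] at h1
  have q1 := h1.dotProduct_mulVec_nonneg y.ofLp
  have q2 := hB.dotProduct_mulVec_nonneg y.ofLp
  simp only [hBdef, star_trivial, Matrix.smul_mulVec, Matrix.sub_mulVec, Matrix.one_mulVec,
    dotProduct_smul, dotProduct_sub, smul_eq_mul] at q1 q2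
  have q3 := nonneg_of_mul_nonneg_right q1 hr
  have e1 : ‖Matrix.toEuclideanCLM (n := Fin n) (𝕜 := ℝ) A y‖ ^ 2 =
      y.ofLp ⬝ᵥ (A * A) *ᵥ y.ofLp := by
    have hT : Aᵀ = A := by simpa using hAs
    rw [← real_inner_self_eq_norm_sq, Matrix.inner_toEuclideanCLM, Matrix.ofLp_toEuclideanCLM,
      ← Matrix.mulVec_mulVec, Matrix.dotProduct_mulVec y.ofLp A, ← Matrix.mulVec_transpose, hT]
  have e2 : ‖y‖ ^ 2 = y.ofLp ⬝ᵥ y.ofLp := by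
    rw [← real_inner_self_eq_norm_sq, EuclideanSpace.inner_eq_star_dotProduct]
    simp
  refine le_of_sq_le_sq ?_ (by positivity)
  rw [mul_pow, e1, e2]
  nlinarith

lemma posSemidef_smul_one_sub {A : Matrix (Fin n) (Fin n) ℝ} (hA : A.IsHermitian) {r : ℝ}
    (hr : ‖Matrix.toEuclideanCLM (n := Fin n) (𝕜 := ℝ) A‖ ≤ r) :
    (r • (1 : Matrix (Fin n) (Fin n) ℝ) - A).PosSemidef := by
  refine Matrix.PosSemidef.of_dotProduct_mulVec_nonneg ?_ fun y => ?_
  · exact (Matrix.isHermitian_one.smul (IsSelfAdjoint.all r)).sub hA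
  · set z : EuclideanSpace ℝ (Fin n) := WithLp.toLp 2 y with hz
    have h1 : inner ℝ z (Matrix.toEuclideanCLM (n := Fin n) (𝕜 := ℝ) A z) ≤ r * ‖z‖ ^ 2 := by
      refine (real_inner_le_norm _ _).trans ?_
      have := (ContinuousLinearMap.le_opNorm (Matrix.toEuclideanCLM (n := Fin n) (𝕜 := ℝ) A) z).trans
        (mul_le_mul_of_nonneg_right hr (norm_nonneg z))
      nlinarith [norm_nonneg z]
    have e2 : ‖z‖ ^ 2 = y ⬝ᵥ y := by
      rw [← real_inner_self_eq_norm_sq, EuclideanSpace.inner_eq_star_dotProduct]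
      simp [hz]
    rw [Matrix.inner_toEuclideanCLM, e2] at h1
    simpa [Matrix.sub_mulVec, Matrix.smul_mulVec] using h1

/-! ### Localisation and rescaling. -/

lemma continuous_hessian {U : EuclideanSpace ℝ (Fin n) → ℝ} (hU : ContDiff ℝ 2 U) :
    Continuous (hessian U) := by
  have h1 : Continuous (fderiv ℝ (fderiv ℝ U)) :=
    (hU.fderiv_right (m := 1) (by norm_num)).continuous_fderiv (by norm_num)
  refine continuous_matrix fun i j => ?_
  simp only [hessian, Matrix.of_apply]
  fun_prop

lemma hessian_congr {U u : EuclideanSpace ℝ (Fin n) → ℝ} {z : EuclideanSpace ℝ (Fin n)}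
    (h : U =ᶠ[𝓝 z] u) : hessian U z = hessian u z := by
  simp only [hessian, h.fderiv.fderiv_eq]

/-- Multiplying `u` by a bump supported in `Ω` yields a global function, for which the integrals
above need no domain conditions. -/
lemma exists_contDiff_hasCompactSupport_eqOn_ball {E : Type*} [NormedAddCommGroup E]
    [InnerProductSpace ℝ E] [FiniteDimensional ℝ E] {Ω : Set E} (hΩ : IsOpen Ω) {u : E → ℝ}
    {m : ℕ∞} (hu : ContDiffOn ℝ m u Ω) {x : E} (hx : x ∈ Ω) :
    ∃ U : E → ℝ, ∃ ρ > 0, ContDiff ℝ m U ∧ HasCompactSupport U ∧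
      Metric.ball x ρ ⊆ Ω ∧ Set.EqOn U u (Metric.ball x ρ) := by
  obtain ⟨R, hR, hRΩ⟩ := Metric.nhds_basis_closedBall.mem_iff.1 (hΩ.mem_nhds hx)
  let χ : ContDiffBump x := ⟨R / 2, R, by positivity, by linarith⟩
  refine ⟨fun y => χ y * u y, R / 2, by positivity, ?_, χ.hasCompactSupport.mul_right, ?_, ?_⟩
  · refine contDiff_iff_contDiffAt.2 fun y => ?_
    by_cases hy : y ∈ Ω
    · exact χ.contDiffAt.mul (hu.contDiffAt (hΩ.mem_nhds hy))
    · have hy' : y ∉ tsupport χ := by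
        rw [χ.tsupport_eq]
        exact fun h => hy (hRΩ h)
      refine (contDiffAt_const (c := (0 : ℝ))).congr_of_eventuallyEq ?_
      filter_upwards [notMem_tsupport_iff_eventuallyEq.1 hy'] with z hz
      simp [hz]
  · exact ((Metric.ball_subset_ball (by linarith)).trans Metric.ball_subset_closedBall).trans hRΩ
  · intro y hy
    simp [χ.one_of_mem_closedBall (Metric.ball_subset_closedBall hy)]

lemma ballMean_eq_average {U u : EuclideanSpace ℝ (Fin n) → ℝ} {x : EuclideanSpace ℝ (Fin n)}
    {ε : ℝ} (hε : 0 < ε) {A : Matrix (Fin n) (Fin n) ℝ}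
    (h : ∀ y ∈ Metric.ball (0 : EuclideanSpace ℝ (Fin n)) ε,
      U (x + Matrix.toEuclideanCLM (n := Fin n) (𝕜 := ℝ) A y) =
        u (x + Matrix.toEuclideanCLM (n := Fin n) (𝕜 := ℝ) A y)) :
    ballMean u x ε A = ⨍ y in Metric.ball 0 1,
      U (x + (ε • Matrix.toEuclideanCLM (n := Fin n) (𝕜 := ℝ) A) y) := by
  have h1 : ballMean u x ε A = ⨍ y in Metric.ball 0 ε,
      U (x + Matrix.toEuclideanCLM (n := Fin n) (𝕜 := ℝ) A y) := by
    rw [ballMean, setAverage_eq, setAverage_eq]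
    congr 1
    exact setIntegral_congr_fun Metric.isOpen_ball.measurableSet fun y hy => (h y hy).symm
  have h2 := Measure.setIntegral_comp_smul_of_pos volume
    (fun y => U (x + Matrix.toEuclideanCLM (n := Fin n) (𝕜 := ℝ) A y)) (Metric.ball 0 1) hε
  rw [smul_unitBall_of_pos hε] at h2
  simp only [map_smul] at h2
  rw [h1, setAverage_eq, setAverage_eq]
  simp only [smul_apply, h2]
  rw [Measure.real, Measure.real, Measure.addHaar_ball_of_pos _ _ hε, ENNReal.toReal_mul,
    ENNReal.toReal_ofReal (by positivity), mul_inv, smul_smul, mul_comm]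

/-! ### Bounds over the family of matrices. -/

variable {𝒜 : Set (Matrix (Fin n) (Fin n) ℝ)}

lemma coe_toReal_F (h𝒜 : 𝒜.Nonempty) {M : Matrix (Fin n) (Fin n) ℝ} (hM : M ∈ Gam 𝒜) :
    ((F 𝒜 M).toReal : EReal) = F 𝒜 M := by
  obtain ⟨A, hA⟩ := h𝒜
  exact EReal.coe_toReal ((iInf₂_le A hA).trans_lt (EReal.coe_lt_top _)).ne hM.2.ne'

/-- Admissibility keeps the nearby Hessians in `Γ_𝒜`, where `F` is continuous. Since `F` is an
infimum, a lower bound on it holds for every `A` on one common neighbourhood. -/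
lemma eventually_forall_le_trace {Ω : Set (EuclideanSpace ℝ (Fin n))} (hΩ : IsOpen Ω)
    {u U : EuclideanSpace ℝ (Fin n) → ℝ} (hF : ContinuousOn (F 𝒜) (Gam 𝒜)) (h𝒜 : 𝒜.Nonempty)
    (hu : IsAdmissible 𝒜 Ω u) {x : EuclideanSpace ℝ (Fin n)} (hx : x ∈ Ω) (hU : ContDiff ℝ 2 U)
    (hUu : U =ᶠ[𝓝 x] u) {η : ℝ} (hη : 0 < η) :
    ∀ᶠ z in 𝓝 x, ∀ A ∈ 𝒜, (F 𝒜 (hessian u x)).toReal - η ≤ (Aᵀ * hessian U z * A).trace := by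
  have hUx := hessian_congr hUu
  have hev : ∀ᶠ z in 𝓝 x, hessian U z ∈ Gam 𝒜 := by
    filter_upwards [hUu.eventually_nhds, hΩ.mem_nhds hx] with z hz hzΩ
    rw [hessian_congr hz]
    exact hu.2 z hzΩ
  have ht : Tendsto (hessian U) (𝓝 x) (𝓝[Gam 𝒜] (hessian u x)) :=
    tendsto_nhdsWithin_iff.2 ⟨hUx ▸ (continuous_hessian hU).tendsto x, hev⟩
  have hlt : (((F 𝒜 (hessian u x)).toReal - η : ℝ) : EReal) < F 𝒜 (hessian u x) := by
    rw [← coe_toReal_F h𝒜 (hu.2 x hx), EReal.toReal_coe]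
    exact_mod_cast sub_lt_self _ hη
  filter_upwards [((hF _ (hu.2 x hx)).tendsto.comp ht).eventually_const_lt hlt] with z hz A hA
  exact EReal.coe_le_coe_iff.1 (hz.le.trans (iInf₂_le A hA))

lemma exists_trace_lt (h𝒜 : 𝒜.Nonempty) {M : Matrix (Fin n) (Fin n) ℝ} (hM : M ∈ Gam 𝒜)
    {η : ℝ} (hη : 0 < η) : ∃ A ∈ 𝒜, (Aᵀ * M * A).trace < (F 𝒜 M).toReal + η := by
  have hlt : F 𝒜 M < (((F 𝒜 M).toReal + η : ℝ) : EReal) := by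
    rw [← coe_toReal_F h𝒜 hM, EReal.toReal_coe]
    exact_mod_cast lt_add_of_pos_right _ hη
  obtain ⟨A, hA, h⟩ := by simpa only [F, iInf_lt_iff, exists_prop] using hlt
  exact ⟨A, hA, EReal.coe_lt_coe_iff.1 h⟩

lemma norm_toEuclideanCLM_lt_of_mem_truncation (hpsd : ∀ A ∈ 𝒜, A.PosSemidef) {r ε δ : ℝ}
    (hr : 0 < r) (h : ε * r < δ) {A : Matrix (Fin n) (Fin n) ℝ} (hA : A ∈ truncation 𝒜 r)
    {y : EuclideanSpace ℝ (Fin n)} (hy : ‖y‖ ≤ ε) :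
    ‖Matrix.toEuclideanCLM (n := Fin n) (𝕜 := ℝ) A y‖ < δ :=
  calc _ ≤ r * ‖y‖ := norm_toEuclideanCLM_le hr (hpsd A hA.1) hA.2 y
    _ ≤ r * ε := mul_le_mul_of_nonneg_left hy hr.le
    _ < δ := by rwa [mul_comm]

lemma le_ballMean_sub_of_le_trace (hn : 1 ≤ n) {U u : EuclideanSpace ℝ (Fin n) → ℝ}
    {x : EuclideanSpace ℝ (Fin n)} (hU : ContDiff ℝ 2 U) (hc : HasCompactSupport U) {δ : ℝ}
    (hδ : 0 < δ) (hUu : Set.EqOn U u (Metric.ball x δ)) {ε c : ℝ} (hε : 0 < ε)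
    {A : Matrix (Fin n) (Fin n) ℝ}
    (hA : ∀ y ∈ Metric.ball (0 : EuclideanSpace ℝ (Fin n)) ε,
      ‖Matrix.toEuclideanCLM (n := Fin n) (𝕜 := ℝ) A y‖ < δ)
    (h : ∀ z ∈ Metric.ball x δ, c ≤ (Aᵀ * hessian U z * A).trace) :
    ε ^ 2 / (2 * (n + 2)) * c ≤ ballMean u x ε A - u x := by
  have hball {y : EuclideanSpace ℝ (Fin n)} (hy : y ∈ Metric.ball 0 ε) :
      x + Matrix.toEuclideanCLM (n := Fin n) (𝕜 := ℝ) A y ∈ Metric.ball x δ := by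
    simpa [mem_ball_iff_norm] using hA y hy
  rw [ballMean_eq_average hε fun y hy => hUu (hball hy), ← hUu (Metric.mem_ball_self hδ),
    div_mul_eq_mul_div]
  refine le_average_sub_of_le_lapComp hn hU hc x _ fun y hy => ?_
  rw [lapComp_smul, lapComp_toEuclideanCLM]
  refine mul_le_mul_of_nonneg_left (h _ (hball ?_)) (sq_nonneg ε)
  rw [← smul_unitBall_of_pos hε]
  exact Set.smul_mem_smul_set hy

lemma ballMean_sub_le_of_trace_le (hn : 1 ≤ n) {U u : EuclideanSpace ℝ (Fin n) → ℝ}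
    {x : EuclideanSpace ℝ (Fin n)} (hU : ContDiff ℝ 2 U) (hc : HasCompactSupport U) {δ : ℝ}
    (hδ : 0 < δ) (hUu : Set.EqOn U u (Metric.ball x δ)) {ε c : ℝ} (hε : 0 < ε)
    {A : Matrix (Fin n) (Fin n) ℝ}
    (hA : ∀ y ∈ Metric.ball (0 : EuclideanSpace ℝ (Fin n)) ε,
      ‖Matrix.toEuclideanCLM (n := Fin n) (𝕜 := ℝ) A y‖ < δ)
    (h : ∀ z ∈ Metric.ball x δ, (Aᵀ * hessian U z * A).trace ≤ c) :
    ballMean u x ε A - u x ≤ ε ^ 2 / (2 * (n + 2)) * c := by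
  have hball {y : EuclideanSpace ℝ (Fin n)} (hy : y ∈ Metric.ball 0 ε) :
      x + Matrix.toEuclideanCLM (n := Fin n) (𝕜 := ℝ) A y ∈ Metric.ball x δ := by
    simpa [mem_ball_iff_norm] using hA y hy
  rw [ballMean_eq_average hε fun y hy => hUu (hball hy), ← hUu (Metric.mem_ball_self hδ),
    div_mul_eq_mul_div]
  refine average_sub_le_of_lapComp_le hn hU hc x _ fun y hy => ?_
  rw [lapComp_smul, lapComp_toEuclideanCLM]
  refine mul_le_mul_of_nonneg_left (h _ (hball ?_)) (sq_nonneg ε)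
  rw [← smul_unitBall_of_pos hε]
  exact Set.smul_mem_smul_set hy

end MeanValue

/-! ### The asymptotic expansion. -/

theorem theorem1p5 (n : ℕ) (hn : 1 ≤ n)
    (𝒜 : Set (Matrix (Fin n) (Fin n) ℝ)) (h𝒜 : 𝒜.Nonempty)
    (hpsd : ∀ A ∈ 𝒜, A.PosSemidef)
    (hF : ContinuousOn (MeanValue.F 𝒜) (MeanValue.Gam 𝒜))
    (Ω : Set (EuclideanSpace ℝ (Fin n))) (hΩ : IsOpen Ω)
    (u : EuclideanSpace ℝ (Fin n) → ℝ) (hu : MeanValue.IsAdmissible 𝒜 Ω u)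
    (φ : ℝ → ℝ) (hφpos : ∀ ε : ℝ, 0 < ε → 0 < φ ε)
    (hφ : Tendsto φ (𝓝[>] 0) atTop)
    (hεφ : Tendsto (fun ε => ε * φ ε) (𝓝[>] 0) (𝓝 0))
    (x : EuclideanSpace ℝ (Fin n)) (hx : x ∈ Ω) :
    -- for small `ε` the infimum is a genuine one: the set of matrices is nonempty, the averages
    -- only involve values of `u` in `Ω`, the integrals exist and are bounded below
    (∀ᶠ ε in 𝓝[>] (0 : ℝ),
      (MeanValue.truncation 𝒜 (φ ε)).Nonempty ∧
      (∀ A ∈ MeanValue.truncation 𝒜 (φ ε),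
        (∀ y ∈ Metric.ball (0 : EuclideanSpace ℝ (Fin n)) ε,
          x + Matrix.toEuclideanCLM (n := Fin n) (𝕜 := ℝ) A y ∈ Ω) ∧
        IntegrableOn (fun y => u (x + Matrix.toEuclideanCLM (n := Fin n) (𝕜 := ℝ) A y))
          (Metric.ball 0 ε)) ∧
      BddBelow (MeanValue.ballMean u x ε '' MeanValue.truncation 𝒜 (φ ε))) ∧
    (fun ε : ℝ =>
      sInf (MeanValue.ballMean u x ε '' MeanValue.truncation 𝒜 (φ ε)) - u x
        - ε ^ 2 / (2 * ((n : ℝ) + 2)) * (MeanValue.F 𝒜 (MeanValue.hessian u x)).toReal)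
      =o[𝓝[>] 0] (fun ε : ℝ => ε ^ 2) := by
  obtain ⟨U, ρ, hρ, hU, hc, hρΩ, hUu⟩ :=
    MeanValue.exists_contDiff_hasCompactSupport_eqOn_ball (m := 2) hΩ hu.1 hx
  have hU2 : ContDiff ℝ 2 U := hU
  have hUux : U =ᶠ[𝓝 x] u := hUu.eventuallyEq_of_mem (Metric.ball_mem_nhds x hρ)
  set f := (MeanValue.F 𝒜 (MeanValue.hessian u x)).toReal with hf
  have hpos : ∀ᶠ ε in 𝓝[>] (0 : ℝ), 0 < ε := eventually_mem_nhdsWithin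
  have htrunc {A : Matrix (Fin n) (Fin n) ℝ} (hA : A ∈ 𝒜) :
      ∀ᶠ ε in 𝓝[>] (0 : ℝ), A ∈ MeanValue.truncation 𝒜 (φ ε) := by
    filter_upwards [hφ.eventually_ge_atTop ‖Matrix.toEuclideanCLM (n := Fin n) (𝕜 := ℝ) A‖]
      with ε hε
    exact ⟨hA, MeanValue.posSemidef_smul_one_sub (hpsd A hA).isHermitian hε⟩
  have hsmall {δ : ℝ} (hδ : 0 < δ) : ∀ᶠ ε in 𝓝[>] (0 : ℝ),
      ∀ A ∈ MeanValue.truncation 𝒜 (φ ε), ∀ y ∈ Metric.ball (0 : EuclideanSpace ℝ (Fin n)) ε,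
        ‖Matrix.toEuclideanCLM (n := Fin n) (𝕜 := ℝ) A y‖ < δ := by
    filter_upwards [hpos, hεφ.eventually_lt_const hδ] with ε hε hlt A hA y hy
    exact MeanValue.norm_toEuclideanCLM_lt_of_mem_truncation hpsd (hφpos ε hε) hlt hA
      (mem_ball_zero_iff.1 hy).le
  have hlower {η : ℝ} (hη : 0 < η) : ∀ᶠ ε in 𝓝[>] (0 : ℝ),
      ∀ A ∈ MeanValue.truncation 𝒜 (φ ε),
        ε ^ 2 / (2 * ((n : ℝ) + 2)) * (f - η) ≤ MeanValue.ballMean u x ε A - u x := by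
    obtain ⟨δ, hδ, hδh⟩ := Metric.eventually_nhds_iff_ball.1
      (MeanValue.eventually_forall_le_trace hΩ hF h𝒜 hu hx hU2 hUux hη)
    filter_upwards [hpos, hsmall (lt_min hδ hρ)] with ε hε hs A hA
    exact MeanValue.le_ballMean_sub_of_le_trace hn hU2 hc (lt_min hδ hρ)
      (hUu.mono (Metric.ball_subset_ball (min_le_right _ _))) hε (hs A hA)
      fun z hz => hδh z (Metric.ball_subset_ball (min_le_left _ _) hz) A hA.1
  -- `A` is chosen before `ε`, so continuity of the trace for this single matrix suffices.
  have hupper {η : ℝ} (hη : 0 < η) : ∀ᶠ ε in 𝓝[>] (0 : ℝ),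
      ∃ A ∈ MeanValue.truncation 𝒜 (φ ε),
        MeanValue.ballMean u x ε A - u x ≤ ε ^ 2 / (2 * ((n : ℝ) + 2)) * (f + η) := by
    obtain ⟨A, hA, hlt⟩ := MeanValue.exists_trace_lt h𝒜 (hu.2 x hx) hη
    rw [← hf, ← MeanValue.hessian_congr hUux] at hlt
    have hcont : Continuous fun z => (Aᵀ * MeanValue.hessian U z * A).trace := by
      have := MeanValue.continuous_hessian hU2
      fun_prop
    obtain ⟨δ, hδ, hδh⟩ := Metric.eventually_nhds_iff_ball.1
      ((hcont.tendsto x).eventually_lt_const hlt)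
    filter_upwards [hpos, hsmall (lt_min hδ hρ), htrunc hA] with ε hε hs hAε
    exact ⟨A, hAε, MeanValue.ballMean_sub_le_of_trace_le hn hU2 hc (lt_min hδ hρ)
      (hUu.mono (Metric.ball_subset_ball (min_le_right _ _))) hε (hs A hAε)
      fun z hz => (hδh z (Metric.ball_subset_ball (min_le_left _ _) hz)).le⟩
  have hne : ∀ᶠ ε in 𝓝[>] (0 : ℝ), (MeanValue.truncation 𝒜 (φ ε)).Nonempty := by
    obtain ⟨A, hA⟩ := h𝒜
    filter_upwards [htrunc hA] with ε hε using ⟨A, hε⟩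
  have hbdd {η ε : ℝ} (h : ∀ A ∈ MeanValue.truncation 𝒜 (φ ε),
      ε ^ 2 / (2 * ((n : ℝ) + 2)) * (f - η) ≤ MeanValue.ballMean u x ε A - u x) :
      u x + ε ^ 2 / (2 * ((n : ℝ) + 2)) * (f - η) ∈
        lowerBounds (MeanValue.ballMean u x ε '' MeanValue.truncation 𝒜 (φ ε)) := by
    rintro _ ⟨A, hA, rfl⟩
    linarith [h A hA]
  refine ⟨?_, ?_⟩
  -- Any positive `η` would do here; it only serves to bound the means below.
  · filter_upwards [hne, hsmall hρ, hlower one_pos] with ε hε hs hl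
    refine ⟨hε, fun A hA => ?_, ⟨_, hbdd hl⟩⟩
    have hball (y : EuclideanSpace ℝ (Fin n)) (hy : y ∈ Metric.ball 0 ε) :
        x + Matrix.toEuclideanCLM (n := Fin n) (𝕜 := ℝ) A y ∈ Metric.ball x ρ := by
      simpa [mem_ball_iff_norm] using hs A hA y hy
    refine ⟨fun y hy => hρΩ (hball y hy), ?_⟩
    have hcont : Continuous fun y => U (x + Matrix.toEuclideanCLM (n := Fin n) (𝕜 := ℝ) A y) := by
      have := hU2.continuous
      fun_prop
    exact ((hcont.continuousOn.integrableOn_compact (isCompact_closedBall 0 ε)).mono_set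
      Metric.ball_subset_closedBall).congr_fun (fun y hy => hUu (hball y hy))
      Metric.isOpen_ball.measurableSet
  · refine isLittleO_iff.2 fun η hη => ?_
    filter_upwards [hne, hlower hη, hupper hη] with ε hε hl ⟨A, hA, hAu⟩
    have h1 := le_csInf (hε.image _) (hbdd hl)
    have h2 := csInf_le ⟨_, hbdd hl⟩ (Set.mem_image_of_mem (MeanValue.ballMean u x ε) hA)
    -- Since `2(n+2) ≥ 1`, the same `η` serves as the little-o constant.
    have h3 : ε ^ 2 / (2 * ((n : ℝ) + 2)) * η ≤ η * ε ^ 2 := by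
      rw [mul_comm η]
      refine mul_le_mul_of_nonneg_right (div_le_self (sq_nonneg ε) ?_) hη.le
      have : (0 : ℝ) ≤ n := n.cast_nonneg
      linarith
    rw [Real.norm_eq_abs, Real.norm_of_nonneg (sq_nonneg ε), abs_le]
    constructor <;> linarith
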